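/- Let $1\to S\xrightarrow{\,i\,}G\xrightarrow{\,\tau\,}T\to 1$ be a short exact sequence of connected real Lie groups, and let $\Gamma\subset G$ be a discrete subgroup whose image $\Lambda=\tau(\Gamma)\subset T$ is discrete. The coset spaces $G/\Gamma$, $T/\Lambda$ and $S/\Gamma_S$, where $\Gamma_S=i^{-1}(\Gamma)$, are pointed by the class of $1$. Write the product $\alpha\beta$ in a fundamental group for the class of a loop representing $\beta$ followed by a loop representing $\alpha$. Let $f\colon\pi_1(G/\Gamma)\to\Gamma$ be the homomorphism that sends the class of a loop to the end point of its lift to $G$ starting at $1$, and let $f_T\colon\pi_1(T/\Lambda)\to\Lambda$ be the analogous homomorphism for the covering $T\to T/\Lambda$. Let $$\pi_1(T/\Lambda)\times_\Lambda\Gamma=\{(x,\gamma)\in\pi_1(T/\Lambda)\times\Gamma : f_T(x)=\tau(\gamma)\},$$ let $\chi\colon\pi_1(S)\to\pi_1(S/\Gamma_S)\to\pi_1(G/\Gamma)$ be the composite of the homomorphisms induced by the projection $S\to S/\Gamma_S$ and by $i$, and let $$\phi\colon\pi_1(G/\Gamma)\to\pi_1(T/\Lambda)\times_\Lambda\Gamma,\qquad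 \phi(y)=(\tau_*(y),f(y)),$$ where $\tau_*$ is induced by $\tau$. Then the sequence $$\pi_1(S)\xrightarrow{\ \chi\ }\pi_1(G/\Gamma)\xrightarrow{\ \phi\ }\pi_1(T/\Lambda)\times_\Lambda\Gamma\to 1$$ is exact. In particular, if $S$ is simply connected, then $\phi$ is an isomorphism. -/

import Mathlib

open scoped Manifold ContDiff

noncomputable section

/-- The fiber product `A ×_C B` of two group homomorphisms `f : A → C` and `g : B → C`:
the group of pairs `(a, b)` with `f a = g b`. -/
def fiberProduct {A B C : Type*} [Group A] [Group B] [Group C] (f : A →* C) (g : B →* C) :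
    Subgroup (A × B) where
  carrier := {p | f p.1 = g p.2}
  one_mem' := by simp
  mul_mem' := by
    intro p q hp hq
    simp only [Set.mem_ofPred_eq] at hp hq
    simp [hp, hq]
  inv_mem' := by
    intro p hp
    simp only [Set.mem_ofPred_eq] at hp
    simp [hp]

section Coset

variable {A B : Type*} [Group A] [TopologicalSpace A] [Group B] [TopologicalSpace B]

/-- The fundamental group of the coset space `A / N`, based at the coset of `1`.
In Mathlib's fundamental group, `p * q` is the class of the loop "first `q`, then `p`". -/
abbrev CosetPi1 (N : Subgroup A) : Type _ :=
  FundamentalGroup (A ⧸ N) (QuotientGroup.mk (1 : A))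

/-- The projection `A → A / N` as a continuous map. -/
def cosetProj (N : Subgroup A) : C(A, A ⧸ N) :=
  ⟨QuotientGroup.mk, QuotientGroup.continuous_mk⟩

/-- The homomorphism `π₁(A, 1) → π₁(A / N)` induced by the projection `A → A / N`. -/
def cosetProjPi1 (N : Subgroup A) : FundamentalGroup A (1 : A) →* CosetPi1 N :=
  FundamentalGroup.mapOfEq (cosetProj N) rfl

/-- The continuous map `A / N → B / M`, `aN ↦ φ(a)M`, induced by a continuous homomorphism
`φ : A → B` with `φ(N) ⊆ M`. -/
def cosetMap (φ : A →ₜ* B) (N : Subgroup A) (M : Subgroup B) (h : ∀ a ∈ N, φ a ∈ M) :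
    C(A ⧸ N, B ⧸ M) where
  toFun := Quotient.map' φ fun a b hab => by
    rw [QuotientGroup.leftRel_apply] at hab ⊢
    simpa using h _ hab
  continuous_toFun := φ.continuous_toFun.quotient_map' _

theorem cosetMap_one (φ : A →ₜ* B) (N : Subgroup A) (M : Subgroup B) (h : ∀ a ∈ N, φ a ∈ M) :
    cosetMap φ N M h (QuotientGroup.mk (1 : A)) = QuotientGroup.mk (1 : B) :=
  congrArg (QuotientGroup.mk : B → B ⧸ M) (map_one φ)

/-- The homomorphism `π₁(A / N) → π₁(B / M)` induced by `aN ↦ φ(a)M`. -/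
def cosetMapPi1 (φ : A →ₜ* B) (N : Subgroup A) (M : Subgroup B) (h : ∀ a ∈ N, φ a ∈ M) :
    CosetPi1 N →* CosetPi1 M :=
  FundamentalGroup.mapOfEq (cosetMap φ N M h)
    (cosetMap_one φ N M h)

variable [IsTopologicalGroup A]

/-- For a discrete subgroup `N` of `A` the projection `A → A / N` is a covering map. -/
theorem isCoveringMap_cosetProj (N : Subgroup A) [DiscreteTopology N] :
    IsCoveringMap (QuotientGroup.mk : A → A ⧸ N) :=
  (N.isQuotientCoveringMap ⟨inferInstance⟩).isCoveringMap

/-- The connecting homomorphism `π₁(A / N) → N` of the covering `A → A / N`, for a discrete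
subgroup `N` of `A`: the class of a loop `θ` goes to the end point of the lift of `θ` to `A`
that starts at `1`. -/
def connectingHom (N : Subgroup A) [DiscreteTopology N] : CosetPi1 N →* N where
  toFun y := ⟨(isCoveringMap_cosetProj N).monodromy y ⟨1, rfl⟩, by
    have h := ((isCoveringMap_cosetProj N).monodromy y ⟨1, rfl⟩).2
    have h' : (QuotientGroup.mk (1 : A) : A ⧸ N) = QuotientGroup.mk _ := h.symm
    simpa using QuotientGroup.eq.1 h'⟩
  map_one' := by
    apply Subtype.ext
    change ((isCoveringMap_cosetProj N).monodromy (.refl _) ⟨1, rfl⟩ : A) = 1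
    rw [IsCoveringMap.monodromy_refl]
    rfl
  map_mul' p q := by
    apply Subtype.ext
    have hN : IsQuotientCoveringMap (QuotientGroup.mk : A → A ⧸ N) N.op :=
      N.isQuotientCoveringMap ⟨inferInstance⟩
    have key (y : CosetPi1 N) :
        ((isCoveringMap_cosetProj N).monodromy y ⟨1, rfl⟩ : A) =
          ((hN.fundamentalGroupToMulOpposite ⟨1, rfl⟩ y).unop : Aᵐᵒᵖ).unop := by
      have := hN.unop_fundamentalGroupToMulOpposite_smul (e := ⟨(1 : A), rfl⟩) (γ := y)
      rw [← this]
      simp [Subgroup.smul_def]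
    simp only [key, map_mul, Subgroup.coe_mul, MulOpposite.unop_mul]

/-- If `θ` is a path in `A` from `1` to `a ∈ N`, then the connecting homomorphism sends the class
of the image of `θ` in `A / N` to `a`. -/
theorem connectingHom_apply (N : Subgroup A) [DiscreteTopology N] (a : N) (θ : Path (1 : A) a) :
    connectingHom N (FundamentalGroup.fromPath (Path.Homotopic.Quotient.mk
      ((θ.map (cosetProj N).continuous).cast rfl
        (show (QuotientGroup.mk 1 : A ⧸ N) = QuotientGroup.mk (a : A) by
          rw [QuotientGroup.eq]; simp)))) = a := by
  apply Subtype.ext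
  have cov := isCoveringMap_cosetProj N
  have h0 : cosetProj N (θ 0) = (QuotientGroup.mk (1 : A) : A ⧸ N) := by rw [θ.source]; rfl
  change cov.liftPath ((cosetProj N).comp θ.toContinuousMap) 1 h0 1 = a
  have key : θ.toContinuousMap = cov.liftPath ((cosetProj N).comp θ.toContinuousMap) 1 h0 := by
    rw [cov.eq_liftPath_iff']
    exact ⟨rfl, θ.source⟩
  rw [← key]
  exact θ.target

variable [IsTopologicalGroup B]

/-- The connecting homomorphisms are natural in `(A, N)`. -/
theorem connectingHom_cosetMapPi1 (φ : A →ₜ* B) (N : Subgroup A) (M : Subgroup B)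
    [DiscreteTopology N] [DiscreteTopology M] (h : ∀ a ∈ N, φ a ∈ M) (y : CosetPi1 N) :
    (connectingHom M (cosetMapPi1 φ N M h y) : B) = φ (connectingHom N y) := by
  have covN := isCoveringMap_cosetProj N
  have covM := isCoveringMap_cosetProj M
  have hy := FundamentalGroup.mapOfEq_apply (cosetMap φ N M h) (cosetMap_one φ N M h) y
  unfold cosetMapPi1
  rw [hy]
  clear hy
  obtain ⟨γ⟩ := y
  have h0 : γ 0 = (QuotientGroup.mk (1 : A) : A ⧸ N) := γ.source
  have hc : cosetMap φ N M h ∘ QuotientGroup.mk = QuotientGroup.mk ∘ φ := rfl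
  let γ' : Path (QuotientGroup.mk (1 : B) : B ⧸ M) (QuotientGroup.mk (1 : B)) :=
    (γ.map (cosetMap φ N M h).continuous).cast
      (cosetMap_one φ N M h).symm (cosetMap_one φ N M h).symm
  have h0' : γ' 0 = (QuotientGroup.mk (1 : B) : B ⧸ M) := γ'.source
  change covM.liftPath γ' 1 h0' 1 = φ (covN.liftPath γ 1 h0 1)
  have key : (⟨φ, φ.continuous_toFun⟩ : C(A, B)).comp (covN.liftPath γ 1 h0) =
      covM.liftPath γ' 1 h0' := by
    rw [covM.eq_liftPath_iff']
    refine ⟨?_, ?_⟩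
    · change (QuotientGroup.mk ∘ φ) ∘ covN.liftPath γ 1 h0 = cosetMap φ N M h ∘ γ
      rw [← hc, Function.comp_assoc, covN.liftPath_lifts]
      rfl
    · change φ (covN.liftPath γ 1 h0 0) = 1
      rw [covN.liftPath_zero, map_one]
  rw [← key]
  rfl

end Coset

section Sequence

variable {S G T : Type*} [Group S] [TopologicalSpace S] [Group G] [TopologicalSpace G]
  [Group T] [TopologicalSpace T]

/-- The homomorphism `χ : π₁(S) → π₁(S / Γ_S) → π₁(G / Γ)`, where `Γ_S = i⁻¹(Γ)` is the
intersection of `Γ` with `S`. -/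
def chi (i : S →ₜ* G) (Γ : Subgroup G) : FundamentalGroup S (1 : S) →* CosetPi1 Γ :=
  (cosetMapPi1 i (Γ.comap (i : S →* G)) Γ fun _ h => h).comp
    (cosetProjPi1 (Γ.comap (i : S →* G)))

variable [IsTopologicalGroup G] [IsTopologicalGroup T]

/-- The fiber product `π₁(T / Λ) ×_Λ Γ`, where `Λ = τ(Γ)`, with respect to the connecting
homomorphism `π₁(T / Λ) → Λ` and the restriction `Γ → Λ` of `τ`. -/
abbrev pi1FiberProduct (τ : G →ₜ* T) (Γ : Subgroup G) [DiscreteTopology (Γ.map (τ : G →* T))] :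
    Subgroup (CosetPi1 (Γ.map (τ : G →* T)) × Γ) :=
  fiberProduct (connectingHom (Γ.map (τ : G →* T))) ((τ : G →* T).subgroupMap Γ)

/-- The homomorphism `φ : π₁(G / Γ) → π₁(T / Λ) ×_Λ Γ`, `y ↦ (τ_* y, f y)`, where `Λ = τ(Γ)` and
`f : π₁(G / Γ) → Γ` is the connecting homomorphism. -/
def phi (τ : G →ₜ* T) (Γ : Subgroup G) [DiscreteTopology Γ]
    [DiscreteTopology (Γ.map (τ : G →* T))] : CosetPi1 Γ →* pi1FiberProduct τ Γ :=
  ((cosetMapPi1 τ Γ (Γ.map (τ : G →* T)) fun _ h => Subgroup.mem_map_of_mem _ h).prod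
    (connectingHom Γ)).codRestrict _ fun y =>
      Subtype.ext (connectingHom_cosetMapPi1 τ Γ (Γ.map (τ : G →* T)) _ y)

end Sequence

end

/-!
The proof is the long exact homotopy sequence of `S → G → T`, combined with the coverings
`G → G / Γ` and `T → T / Λ`.

As `G → G / Γ` is a covering, an element of `π₁(G / Γ)` with `f(y) = γ` is the same as a homotopy
class of paths in `G` from `1` to `γ` (`exists_eq_cosetLoop`, `cosetLoop_eq_iff`), and likewise for
`T`. For surjectivity of `φ`, take a path `α` in `T` from `1` to `τ(γ)`, lift it to a path in `G`
from `1`, and multiply the lift by a path in `i(S)` so that it ends at `γ`. For exactness in the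
middle, an element of the kernel of `φ` is the class of a loop `a` in `G` such that `τ ∘ a` is
null-homotopic in `T`. Lifting a null-homotopy to `G` deforms `a` into a loop in `ker τ = i(S)`
(`exists_homotopic_loop_in_ker`), which is a loop in `S` because `i` is an embedding
(`isEmbedding_of_mulExact`).

What has to be lifted are maps from an interval and from a square. They lift as soon as `τ` has a
continuous section near `1` (`exists_continuousMap_lift`). By the open mapping theorem for locally
compact groups `τ` is open, and an open map of class `C¹` is a submersion at every point where its
rank is maximal (`surjective_fderiv_of_forall_finrank_range_le`). This gives a local section at some
point, which is translated to `1` (`exists_continuousOn_section_nhds_one`).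
-/

/-! ### Local sections of open maps of class `C¹` -/

section LocalSection

open Topology Set

variable {E F : Type*} [NormedAddCommGroup E] [NormedSpace ℝ E] [FiniteDimensional ℝ E]
  [NormedAddCommGroup F] [NormedSpace ℝ F] [FiniteDimensional ℝ F]

/-- An open map of class `C¹` has surjective derivative at every point of maximal rank. By the
constant rank argument, the image of a neighbourhood of such a point `x` is the image of a ball in
the range of the derivative `A` at `x`, so its Hausdorff dimension is at most the rank of `A`; but
it is a nonempty open set. -/
theorem surjective_fderiv_of_forall_finrank_range_le {U : Set E} (hU : IsOpen U) {f : E → F}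
    (hf : ContDiffOn ℝ 1 f U) (hopen : ∀ W ⊆ U, IsOpen W → IsOpen (f '' W)) {x : E} (hx : x ∈ U)
    (hmax : ∀ y ∈ U, Module.finrank ℝ (fderiv ℝ f y).range ≤ Module.finrank ℝ (fderiv ℝ f x).range) :
    Function.Surjective (fderiv ℝ f x) := by
  set A : E →L[ℝ] F := fderiv ℝ f x with hA
  have hfx : ContDiffAt ℝ 1 f x := hf.contDiffAt (hU.mem_nhds hx)
  -- a linear projection of `F` onto the range of `A`
  obtain ⟨P, hP⟩ : ∃ P : F →L[ℝ] A.range, ∀ v : A.range, P v = v := by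
    obtain ⟨P, hP⟩ := A.range.exists_isCompl
    exact ⟨LinearMap.toContinuousLinearMap (A.range.projectionOnto P hP),
      fun v => Submodule.projectionOnto_apply_left hP v⟩
  have hder : HasStrictFDerivAt (fun y => P (f y)) (P.comp A) x :=
    P.hasStrictFDerivAt.comp x (hfx.hasStrictFDerivAt one_ne_zero)
  have hsurj : (P.comp A).range = ⊤ := by
    rw [LinearMap.range_eq_top]
    rintro ⟨_, v, rfl⟩
    exact ⟨v, hP ⟨A v, v, rfl⟩⟩
  have hker : (P.comp A).ker.ClosedComplemented :=
    Submodule.ClosedComplemented.of_finiteDimensional _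
  -- straighten the fibres of `P ∘ f` near `x`
  let d := HasStrictFDerivAt.implicitFunctionDataOfComplemented _ _ hder hsurj hker
  let Φ : OpenPartialHomeomorph E (A.range × (P.comp A).ker) := d.toOpenPartialHomeomorph
  have hΦx : x ∈ Φ.source := d.pt_mem_toOpenPartialHomeomorph_source
  have hΦfst (y : E) : (Φ y).1 = P (f y) := rfl
  have hΦ : ContDiffAt ℝ 1 Φ x := by
    refine (P.contDiff.contDiffAt.comp x hfx).prodMk ?_
    exact (ContinuousLinearMap.contDiff _).contDiffAt.comp x (contDiffAt_id.sub contDiffAt_const)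
  have hΦsymm : ContDiffAt ℝ 1 Φ.symm (Φ x) := by
    refine Φ.contDiffAt_symm (Φ.map_source hΦx) (f₀' := ?_) ?_ ?_
    · exact d.leftDeriv.equivProdOfSurjectiveOfIsCompl d.rightDeriv d.range_leftDeriv
        d.range_rightDeriv d.isCompl_ker
    · rw [Φ.left_inv hΦx]
      exact d.hasStrictFDerivAt.hasFDerivAt
    · rwa [Φ.left_inv hΦx]
  obtain ⟨ε, hε, hball⟩ : ∃ ε > 0, ∀ z ∈ Metric.ball (Φ x) ε,
      z ∈ Φ.target ∧ Φ.symm z ∈ U ∧ ContDiffAt ℝ 1 Φ.symm z := by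
    have h1 : ∀ᶠ z in 𝓝 (Φ x), z ∈ Φ.target := Φ.open_target.mem_nhds (Φ.map_source hΦx)
    have h2 : ∀ᶠ z in 𝓝 (Φ x), Φ.symm z ∈ U :=
      hΦsymm.continuousAt.eventually_mem (by rw [Φ.left_inv hΦx]; exact hU.mem_nhds hx)
    have h3 := hΦsymm.eventually (by simp)
    exact Metric.eventually_nhds_iff_ball.1 (h1.and (h2.and h3))
  set h : A.range × (P.comp A).ker → F := fun z => f (Φ.symm z) with hh
  have hcd (z) (hz : z ∈ Metric.ball (Φ x) ε) : ContDiffAt ℝ 1 h z :=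
    (hf.contDiffAt (hU.mem_nhds (hball z hz).2.1)).comp z (hball z hz).2.2
  have hPh (z) (hz : z ∈ Metric.ball (Φ x) ε) : P (h z) = z.1 := by
    rw [← hΦfst, Φ.right_inv (hball z hz).1]
  -- as the rank of `f` is at most that of `A`, the map `h` has zero derivative along the fibres
  have hzero (z) (hz : z ∈ Metric.ball (Φ x) ε) (v : (P.comp A).ker) :
      fderiv ℝ h z (0, v) = 0 := by
    have hd : HasFDerivAt h (fderiv ℝ h z) z :=
      ((hcd z hz).differentiableAt one_ne_zero).hasFDerivAt
    have hcomp : fderiv ℝ h z = (fderiv ℝ f (Φ.symm z)).comp (fderiv ℝ Φ.symm z) :=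
      fderiv_comp z ((hf.contDiffAt (hU.mem_nhds (hball z hz).2.1)).differentiableAt one_ne_zero)
        ((hball z hz).2.2.differentiableAt one_ne_zero)
    have hP' : P.comp (fderiv ℝ h z) = ContinuousLinearMap.fst ℝ _ _ := by
      refine (P.hasFDerivAt.comp z hd).unique ?_
      refine hasFDerivAt_fst.congr_of_eventuallyEq ?_
      filter_upwards [Metric.isOpen_ball.mem_nhds hz] with w hw using hPh w hw
    let Q : (fderiv ℝ h z).range →ₗ[ℝ] A.range := (P : F →ₗ[ℝ] A.range).domRestrict _
    have hQ : Function.Surjective Q := fun w =>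
      ⟨⟨fderiv ℝ h z (w, 0), (w, 0), rfl⟩, DFunLike.congr_fun hP' (w, 0)⟩
    have hle : Module.finrank ℝ (fderiv ℝ h z).range ≤ Module.finrank ℝ A.range := by
      refine le_trans (Submodule.finrank_mono ?_) (hmax _ (hball z hz).2.1)
      rw [hcomp]
      exact LinearMap.range_comp_le_range _ _
    have hinj : Function.Injective Q :=
      (LinearMap.injective_iff_surjective_of_finrank_eq_finrank
        (le_antisymm hle (LinearMap.finrank_le_finrank_of_surjective hQ))).2 hQ
    have h0 : (⟨fderiv ℝ h z (0, v), (0, v), rfl⟩ : (fderiv ℝ h z).range) = 0 :=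
      hinj ((DFunLike.congr_fun hP' (0, v)).trans (map_zero Q).symm)
    exact congrArg Subtype.val h0
  have hprod : Metric.ball (Φ x) ε = Metric.ball (Φ x).1 ε ×ˢ Metric.ball (Φ x).2 ε :=
    (ball_prod_same _ _ _).symm
  have hconst (y) (hy : y ∈ Metric.ball (Φ x).1 ε) (w) (hw : w ∈ Metric.ball (Φ x).2 ε) :
      h (y, w) = h (y, (Φ x).2) := by
    have hd (w) (hw : w ∈ Metric.ball (Φ x).2 ε) :
        HasFDerivAt (fun w => h (y, w))
          ((fderiv ℝ h (y, w)).comp (ContinuousLinearMap.inr ℝ _ _)) w :=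
      ((hcd (y, w) (hprod ▸ ⟨hy, hw⟩)).differentiableAt one_ne_zero).hasFDerivAt.comp w
        (hasFDerivAt_prodMk_right y w)
    refine Metric.isOpen_ball.is_const_of_fderiv_eq_zero (𝕜 := ℝ) (f := fun w => h (y, w))
      (convex_ball (Φ x).2 ε).isPreconnected
      (fun w hw => (hd w hw).differentiableAt.differentiableWithinAt) ?_ hw
      (Metric.mem_ball_self hε)
    intro w hw
    rw [(hd w hw).fderiv]
    ext v
    exact hzero _ (hprod ▸ ⟨hy, hw⟩) v
  -- so an open set is the image of a ball of `A.range`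
  have hsub : h '' Metric.ball (Φ x) ε ⊆
      (fun y => h (y, (Φ x).2)) '' Metric.ball (Φ x).1 ε := by
    rintro _ ⟨⟨y, w⟩, hz, rfl⟩
    rw [hprod] at hz
    exact ⟨y, hz.1, (hconst y hz.1 w hz.2).symm⟩
  have hdim : dimH (h '' Metric.ball (Φ x) ε) ≤ Module.finrank ℝ A.range := by
    refine (dimH_mono hsub).trans ((ContDiffOn.dimH_image_le (t := Metric.ball (Φ x).1 ε) ?_
      (convex_ball (Φ x).1 ε) subset_rfl).trans ?_)
    · intro y hy
      exact ((hcd (y, (Φ x).2) (hprod ▸ ⟨hy, Metric.mem_ball_self hε⟩)).comp y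
        (contDiffAt_id.prodMk contDiffAt_const)).contDiffWithinAt
    · exact (dimH_mono (subset_univ _)).trans (Real.dimH_univ_eq_finrank _).le
  have hopenimg : IsOpen (h '' Metric.ball (Φ x) ε) := by
    have : h '' Metric.ball (Φ x) ε = f '' (Φ.symm '' Metric.ball (Φ x) ε) := image_comp f Φ.symm _
    rw [this]
    refine hopen _ ?_ (Φ.isOpen_image_symm_of_subset_target Metric.isOpen_ball
      fun z hz => (hball z hz).1)
    rintro _ ⟨z, hz, rfl⟩
    exact (hball z hz).2.1
  have hdim' : dimH (h '' Metric.ball (Φ x) ε) = Module.finrank ℝ F := by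
    refine Real.dimH_of_nonempty_interior ?_
    rw [hopenimg.interior_eq]
    exact ⟨_, Φ x, Metric.mem_ball_self hε, rfl⟩
  rw [hdim', Nat.cast_le] at hdim
  have htop : A.range = ⊤ :=
    Submodule.eq_top_of_finrank_eq (le_antisymm (Submodule.finrank_le _) hdim)
  exact LinearMap.range_eq_top.1 htop

/-- An open map of class `C¹` has a continuous section over some nonempty open set. -/
theorem exists_continuousOn_section {U : Set E} (hU : IsOpen U) (hne : U.Nonempty) {f : E → F}
    (hf : ContDiffOn ℝ 1 f U) (hopen : ∀ W ⊆ U, IsOpen W → IsOpen (f '' W)) :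
    ∃ V : Set F, IsOpen V ∧ V.Nonempty ∧ ∃ σ : F → E, ContinuousOn σ V ∧
      ∀ y ∈ V, σ y ∈ U ∧ f (σ y) = y := by
  obtain ⟨x, hx, hmax⟩ : ∃ x ∈ U, ∀ y ∈ U,
      Module.finrank ℝ (fderiv ℝ f y).range ≤ Module.finrank ℝ (fderiv ℝ f x).range := by
    have hfin : ((fun y => Module.finrank ℝ (fderiv ℝ f y).range) '' U).Finite :=
      (Set.finite_Iic (Module.finrank ℝ F)).subset (by
        rintro _ ⟨y, -, rfl⟩
        exact Submodule.finrank_le _)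
    obtain ⟨x, hx, hmax⟩ := Set.exists_max_image _ id hfin (hne.image _)
    obtain ⟨x, hx, rfl⟩ := hx
    exact ⟨x, hx, fun y hy => hmax _ ⟨y, hy, rfl⟩⟩
  have hsurj := surjective_fderiv_of_forall_finrank_range_le hU hf hopen hx hmax
  -- restrict `f` to an affine subspace that the derivative maps isomorphically onto `F`
  obtain ⟨R, hR⟩ := (fderiv ℝ f x : E →ₗ[ℝ] F).exists_rightInverse_of_surjective
    (LinearMap.range_eq_top.2 hsurj)
  let R' : F →L[ℝ] E := LinearMap.toContinuousLinearMap R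
  let j : F → E := fun v => x + R' v
  have hj0 : j 0 = x := by simp [j]
  have hj : HasStrictFDerivAt j R' 0 := R'.hasStrictFDerivAt.const_add x
  have hfj : HasStrictFDerivAt (f ∘ j) ((ContinuousLinearEquiv.refl ℝ F : F ≃L[ℝ] F) : F →L[ℝ] F)
      0 := by
    have hfx : HasStrictFDerivAt f (fderiv ℝ f x) (j 0) := by
      rw [hj0]
      exact (hf.contDiffAt (hU.mem_nhds hx)).hasStrictFDerivAt one_ne_zero
    refine (hfx.comp 0 hj).congr_fderiv ?_
    ext v
    exact DFunLike.congr_fun hR v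
  let e := hfj.toOpenPartialHomeomorph (f ∘ j)
  have he0 : (0 : F) ∈ e.source := hfj.mem_toOpenPartialHomeomorph_source
  have hjc : Continuous j := continuous_const.add R'.continuous
  refine ⟨e.target ∩ e.symm ⁻¹' (j ⁻¹' U), e.isOpen_inter_preimage_symm (hU.preimage hjc),
    ⟨e 0, e.map_source he0, ?_⟩, j ∘ e.symm, ?_, ?_⟩
  · simpa only [mem_preimage, e.left_inv he0, hj0] using hx
  · exact hjc.comp_continuousOn (e.continuousOn_symm.mono inter_subset_left)
  · exact fun y hy => ⟨hy.2, e.right_inv hy.1⟩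

end LocalSection

/-! ### Topology of Lie groups -/

section TopologicalGroups

open Topology Set
open scoped Pointwise

theorem sigmaCompactSpace_of_connectedSpace (A : Type*) [Group A] [TopologicalSpace A]
    [IsTopologicalGroup A] [LocallyCompactSpace A] [ConnectedSpace A] : SigmaCompactSpace A := by
  obtain ⟨K, hK, h1⟩ := exists_compact_mem_nhds (1 : A)
  -- the powers of `K ∪ K⁻¹` cover `A`
  let L : Set A := K ∪ K⁻¹
  have hL : IsCompact L := hK.union hK.inv
  have hpow (n : ℕ) : IsCompact (L ^ n) := by
    induction n with
    | zero => simp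
    | succ n ih => rw [pow_succ]; exact ih.mul hL
  refine ⟨⟨fun n => L ^ n, hpow, ?_⟩⟩
  have hopen : IsOpen (Subgroup.closure K : Set A) :=
    Subgroup.isOpen_of_mem_nhds _ (Filter.mem_of_superset h1 Subgroup.subset_closure)
  have htop : (Subgroup.closure K : Set A) = univ :=
    IsClopen.eq_univ ⟨Subgroup.isClosed_of_isOpen _ hopen, hopen⟩ ⟨1, one_mem _⟩
  refine eq_univ_of_forall fun a => ?_
  have ha : a ∈ Subgroup.closure K := by rw [← SetLike.mem_coe, htop]; trivial
  rw [← Subgroup.mem_toSubmonoid, Subgroup.closure_toSubmonoid] at ha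
  induction ha using Submonoid.closure_induction with
  | mem x hx => exact mem_iUnion.2 ⟨1, by simpa [L] using hx⟩
  | one => exact mem_iUnion.2 ⟨0, by simp⟩
  | mul x y _ _ hx hy =>
    obtain ⟨m, hm⟩ := mem_iUnion.1 hx
    obtain ⟨n, hn⟩ := mem_iUnion.1 hy
    exact mem_iUnion.2 ⟨m + n, by rw [pow_add]; exact mul_mem_mul hm hn⟩

/-- Manifolds are `T0`: a chart domain containing only one of two points separates them, and a
common chart reduces the claim to the model space. Mathlib does not assume manifolds to be
Hausdorff; for topological groups this follows from `T0`. -/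
theorem t0Space_of_chartedSpace (H M : Type*) [TopologicalSpace H] [T0Space H]
    [TopologicalSpace M] [ChartedSpace H M] : T0Space M := by
  refine ⟨fun x y hxy => ?_⟩
  let c := chartAt H x
  have hx : x ∈ c.source := mem_chart_source H x
  have hy : y ∈ c.source := (hxy.mem_open_iff c.open_source).1 hx
  have h1 : Inseparable (c x) (c y) := by
    have h2 : Inseparable (⟨x, hx⟩ : c.source) ⟨y, hy⟩ := by
      rwa [← IsInducing.subtypeVal.inseparable_iff]
    exact h2.map c.continuousOn.domRestrict
  exact c.injOn hx hy h1.eq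

end TopologicalGroups

/-! ### Local sections of surjective homomorphisms of Lie groups -/

section LieGroups

open Topology Set

variable {EG ET : Type*}
    [NormedAddCommGroup EG] [NormedSpace ℝ EG] [FiniteDimensional ℝ EG]
    [NormedAddCommGroup ET] [NormedSpace ℝ ET] [FiniteDimensional ℝ ET]
    {G T : Type*}

theorem LieGroup.locallyCompactSpace_and_t2Space (G : Type*)
    [Group G] [TopologicalSpace G] [ChartedSpace EG G] [IsTopologicalGroup G] :
    LocallyCompactSpace G ∧ T2Space G := by
  have := t0Space_of_chartedSpace EG G
  exact ⟨Manifold.locallyCompact_of_finiteDimensional (𝕜 := ℝ) 𝓘(ℝ, EG), inferInstance⟩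

variable [Group G] [TopologicalSpace G] [ChartedSpace EG G] [LieGroup 𝓘(ℝ, EG) ∞ G]
    [Group T] [TopologicalSpace T] [ChartedSpace ET T] [LieGroup 𝓘(ℝ, ET) ∞ T]

/-- An open smooth homomorphism of Lie groups has a continuous section near `1`: it has one over
some nonempty open set, which is then translated. -/
theorem exists_continuousOn_section_nhds_one [IsTopologicalGroup G] [IsTopologicalGroup T]
    (τ : G →ₜ* T) (hτ : ContMDiff 𝓘(ℝ, EG) 𝓘(ℝ, ET) ∞ τ) (hopen : IsOpenMap τ) :
    ∃ N ∈ 𝓝 (1 : T), ∃ σ : T → G, ContinuousOn σ N ∧ ∀ t ∈ N, τ (σ t) = t := by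
  let cG := chartAt EG (1 : G)
  let cT := chartAt ET (1 : T)
  have h1G : (1 : G) ∈ cG.source := mem_chart_source EG _
  have h1T : (1 : T) ∈ cT.source := mem_chart_source ET _
  let U : Set EG := cG.target ∩ cG.symm ⁻¹' (τ ⁻¹' cT.source)
  have hU : IsOpen U := cG.isOpen_inter_preimage_symm (cT.open_source.preimage τ.continuous_toFun)
  have hne : U.Nonempty := ⟨cG 1, cG.map_source h1G, by
    simpa only [mem_preimage, cG.left_inv h1G, map_one] using h1T⟩
  have hsmooth : ContDiffOn ℝ 1 (cT ∘ τ ∘ cG.symm) U := by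
    have h2 := (contMDiff_iff.1 (hτ.of_le (m := 1) (by simp))).2 1 1
    simpa [U, Function.comp_def] using h2
  obtain ⟨V, hV, ⟨v, hv⟩, σ, hσ, hσV⟩ := exists_continuousOn_section hU hne hsmooth (by
    intro W hWU hW
    rw [image_comp, image_comp]
    refine cT.isOpen_image_of_subset_source (hopen _
      (cG.isOpen_image_symm_of_subset_target hW fun w hw => (hWU hw).1)) ?_
    rintro _ ⟨_, ⟨w, hw, rfl⟩, rfl⟩
    exact (hWU hw).2)
  have hVT : V ⊆ cT.target := fun y hy => by
    rw [← (hσV y hy).2]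
    exact cT.map_source (hσV y hy).1.2
  -- the section over `V` in the charts, and a base point `t₀` at which to translate it to `1`
  let t₀ : T := cT.symm v
  let ρ : T → G := cG.symm ∘ σ ∘ cT
  have hO : IsOpen (cT.source ∩ cT ⁻¹' V) := cT.isOpen_inter_preimage hV
  have hρ : ContinuousOn ρ (cT.source ∩ cT ⁻¹' V) :=
    cG.continuousOn_symm.comp
      (hσ.comp (cT.continuousOn.mono inter_subset_left) fun t ht => ht.2)
      fun t ht => (hσV _ ht.2).1.1
  have hτρ (t) (ht : t ∈ cT.source ∩ cT ⁻¹' V) : τ (ρ t) = t :=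
    cT.injOn (hσV _ ht.2).1.2 ht.1 (hσV _ ht.2).2
  have ht₀ : t₀ ∈ cT.source ∩ cT ⁻¹' V :=
    ⟨cT.map_target (hVT hv), by simpa only [mem_preimage, t₀, cT.right_inv (hVT hv)] using hv⟩
  have hmul : Continuous (t₀ * ·) := continuous_const_mul t₀
  refine ⟨(t₀ * ·) ⁻¹' (cT.source ∩ cT ⁻¹' V), (hO.preimage hmul).mem_nhds ?_,
    fun t => (ρ t₀)⁻¹ * ρ (t₀ * t), ?_, ?_⟩
  · simpa only [mem_preimage, mul_one] using ht₀
  · exact continuousOn_const.mul (hρ.comp hmul.continuousOn fun t ht => ht)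
  · intro t ht
    rw [map_mul, map_inv, hτρ _ ht₀, hτρ _ ht, inv_mul_cancel_left]

end LieGroups

/-! ### Lifting maps and homotopies along a homomorphism with local sections -/

section Lifting

open Topology Set

variable {G T : Type*} [Group G] [TopologicalSpace G] [IsTopologicalGroup G]
  [Group T] [TopologicalSpace T] [IsTopologicalGroup T]

/-- A surjective homomorphism `τ : G → T` with a continuous section near `1` has the lifting
property for maps from compact contractible spaces `X`. The maps `X → T` that lift form a subgroup
of `C(X, T)`; it is open, because it contains all maps into the domain of the section, hence it is
closed as well, so it contains `k`, which a path in `C(X, T)` connects with a constant map. -/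
theorem exists_continuousMap_lift (τ : G →ₜ* T) (hτ : Function.Surjective τ)
    (hsec : ∃ N ∈ 𝓝 (1 : T), ∃ σ : T → G, ContinuousOn σ N ∧ ∀ t ∈ N, τ (σ t) = t)
    {X : Type*} [TopologicalSpace X] [CompactSpace X] [LocallyCompactSpace X]
    [ContractibleSpace X] (k : C(X, T)) :
    ∃ k' : C(X, G), ∀ x, τ (k' x) = k x := by
  obtain ⟨N, hN, σ, hσ, hτσ⟩ := hsec
  let L : Subgroup C(X, T) :=
    (MonoidHom.compLeftContinuous X (τ : G →* T) τ.continuous_toFun).range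
  have hL : IsOpen (L : Set C(X, T)) := by
    refine Subgroup.isOpen_of_mem_nhds _ (g := 1) ?_
    refine Filter.mem_of_superset ((ContinuousMap.isOpen_setOfPred_mapsTo isCompact_univ
      (isOpen_interior (s := N))).mem_nhds fun x _ => mem_interior_iff_mem_nhds.2 hN) fun m hm => ?_
    have hmN (x : X) : m x ∈ N := interior_subset (hm (mem_univ x))
    exact ⟨⟨σ ∘ m, hσ.comp_continuous m.continuous hmN⟩,
      ContinuousMap.ext fun x => hτσ _ (hmN x)⟩
  have hclopen : IsClopen (L : Set C(X, T)) := ⟨Subgroup.isClosed_of_isOpen _ hL, hL⟩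
  obtain ⟨x₀, ⟨H⟩⟩ := id_nullhomotopic X
  let γ : C(unitInterval, C(X, T)) := (k.comp H).curry
  have hγ1 : γ 1 ∈ L := by
    obtain ⟨g, hg⟩ := hτ (k x₀)
    refine ⟨ContinuousMap.const X g, ContinuousMap.ext fun x => ?_⟩
    change τ g = k (H (1, x))
    rw [hg, H.apply_one]
    rfl
  have hγ0 : γ 0 ∈ L :=
    ((hclopen.preimage γ.continuous).eq_univ ⟨1, hγ1⟩).ge (mem_univ (0 : unitInterval))
  obtain ⟨k', hk'⟩ := hγ0
  refine ⟨k', fun x => (DFunLike.congr_fun hk' x).trans ?_⟩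
  change k (H (0, x)) = k x
  rw [H.apply_zero]
  rfl

instance unitInterval.contractibleSpace : ContractibleSpace unitInterval :=
  (convex_Icc (0 : ℝ) 1).contractibleSpace ⟨0, by simp⟩

/-- Exactness of `π₁(ker τ) → π₁(G) → π₁(T)`. The path `p` is `τ ∘ a`; it is a variable of its
own so that its end points are `1` rather than `τ 1`. -/
theorem exists_homotopic_loop_in_ker (τ : G →ₜ* T)
    (hτ : Function.Surjective τ)
    (hsec : ∃ N ∈ 𝓝 (1 : T), ∃ σ : T → G, ContinuousOn σ N ∧ ∀ t ∈ N, τ (σ t) = t)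
    (a : Path (1 : G) 1) (p : Path (1 : T) 1) (hp : ∀ t, p t = τ (a t))
    (hnull : p.Homotopic (Path.refl 1)) :
    ∃ b : Path (1 : G) 1, (∀ t, τ (b t) = 1) ∧ a.Homotopic b := by
  obtain ⟨H⟩ := hnull
  obtain ⟨K, hK⟩ := exists_continuousMap_lift τ hτ hsec (H : C(unitInterval × unitInterval, T))
  replace hK (s t : unitInterval) : τ (K (s, t)) = H (s, t) := hK (s, t)
  -- correct the lift so that it agrees with `a` at `s = 0` and is `1` at `t = 0` ...
  let M : unitInterval × unitInterval → G := fun z =>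
    K z * (K (0, z.2))⁻¹ * a z.2 * K (0, 0) * (K (z.1, 0))⁻¹
  have hM : Continuous M := by fun_prop
  have hτM (s t : unitInterval) : τ (M (s, t)) = H (s, t) := by
    simp [M, hK, hp]
  have hM0 (t : unitInterval) : M (0, t) = a t := by simp [M]
  have hMl (s : unitInterval) : M (s, 0) = 1 := by simp [M]
  -- ... and then also `1` at `t = 1`
  let M' : unitInterval × unitInterval → G := fun z => M z * (M (z.1 * z.2, 1))⁻¹
  have hM' : Continuous M' := by fun_prop
  have hM'0 (t : unitInterval) : M' (0, t) = a t := by simp [M', hM0]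
  have hM'l (s : unitInterval) : M' (s, 0) = 1 := by simp [M', hM0, hMl]
  have hM'r (s : unitInterval) : M' (s, 1) = 1 := by simp [M']
  let b : Path (1 : G) 1 :=
    { toFun := fun t => M' (1, t)
      continuous_toFun := by fun_prop
      source' := hM'l 1
      target' := hM'r 1 }
  refine ⟨b, fun t => ?_, ⟨⟨⟨⟨M', hM'⟩, hM'0, fun t => rfl⟩, ?_⟩⟩⟩
  · change τ (M' (1, t)) = 1
    simp [M', hτM]
  · rintro s t (rfl | rfl)
    · simpa using hM'l s
    · simpa using hM'r s

end Lifting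

section Kernel

open Topology Set

/-- By the open mapping theorem, the first map of an exact sequence is a homeomorphism onto the
kernel of the second one. -/
theorem isEmbedding_of_mulExact {S G T : Type*} [Group S] [TopologicalSpace S]
    [IsTopologicalGroup S] [SigmaCompactSpace S] [Group G] [TopologicalSpace G]
    [IsTopologicalGroup G] [LocallyCompactSpace G] [T2Space G]
    [Group T] [TopologicalSpace T] [T1Space T] (i : S →ₜ* G) (τ : G →ₜ* T)
    (hi : Function.Injective i) (hexact : Function.MulExact i τ) : IsEmbedding i := by
  have hclosed : IsClosed ((τ : G →* T).ker : Set G) :=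
    isClosed_singleton.preimage τ.continuous_toFun
  have : LocallyCompactSpace (τ : G →* T).ker :=
    hclosed.isClosedEmbedding_subtypeVal.locallyCompactSpace
  let j : S →* (τ : G →* T).ker :=
    (i : S →* G).codRestrict _ fun s => (hexact (i s)).2 ⟨s, rfl⟩
  have hjc : Continuous j := i.continuous_toFun.subtype_mk _
  have hj : IsOpenMap j := j.isOpenMap_of_sigmaCompact (by
    rintro ⟨g, hg⟩
    obtain ⟨s, rfl⟩ := (hexact g).1 hg
    exact ⟨s, rfl⟩) hjc
  exact IsEmbedding.subtypeVal.comp 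
    (IsOpenEmbedding.of_continuous_injective_isOpenMap hjc
      (fun s s' h => hi (congrArg Subtype.val h)) hj).isEmbedding

end Kernel

/-! ### Elements of `π₁(A / N)` as paths in `A` -/

noncomputable section CosetLoop

variable {A B : Type*} [Group A] [TopologicalSpace A] [Group B] [TopologicalSpace B]

/-- The class in `π₁(A / N)` of the image of a path `θ` in `A` from `1` to an element `a` of `N`. -/
def cosetLoop (N : Subgroup A) (a : N) (θ : Path (1 : A) a) : CosetPi1 N :=
  FundamentalGroup.fromPath (Path.Homotopic.Quotient.mk
    ((θ.map (cosetProj N).continuous).cast rfl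
      (show (QuotientGroup.mk 1 : A ⧸ N) = QuotientGroup.mk (a : A) by
        rw [QuotientGroup.eq]; simp)))

/-- `cosetLoop` depends only on the function underlying the path. The end points `a` and `a'` may
differ syntactically, in which case the two paths have different types. -/
theorem cosetLoop_congr (N : Subgroup A) {a a' : N} {θ : Path (1 : A) a} {θ' : Path (1 : A) a'}
    (h : ∀ t, θ t = θ' t) : cosetLoop N a θ = cosetLoop N a' θ' := by
  obtain rfl : a = a' := Subtype.ext (by rw [← θ.target, ← θ'.target, h])
  obtain rfl : θ = θ' := Path.ext (funext h)
  rfl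

theorem cosetMapPi1_cosetLoop (φ : A →ₜ* B) (N : Subgroup A) (M : Subgroup B)
    (h : ∀ a ∈ N, φ a ∈ M) (a : N) (θ : Path (1 : A) a) (b : M) (η : Path (1 : B) b)
    (hη : ∀ t, η t = φ (θ t)) :
    cosetMapPi1 φ N M h (cosetLoop N a θ) = cosetLoop M b η := by
  unfold cosetMapPi1
  rw [FundamentalGroup.mapOfEq_apply (cosetMap φ N M h) (cosetMap_one φ N M h)]
  refine congrArg Path.Homotopic.Quotient.mk (Path.ext (funext fun t => ?_))
  exact congrArg (QuotientGroup.mk : B → B ⧸ M) (hη t).symm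

theorem chi_mk {S : Type*} [Group S] [TopologicalSpace S] (i : S →ₜ* A) (N : Subgroup A)
    (σ : Path (1 : S) 1) (θ : Path (1 : A) (1 : N)) (hθ : ∀ t, θ t = i (σ t)) :
    chi i N (FundamentalGroup.fromPath (Path.Homotopic.Quotient.mk σ)) = cosetLoop N 1 θ := by
  have h : cosetProjPi1 (N.comap (i : S →* A))
      (FundamentalGroup.fromPath (Path.Homotopic.Quotient.mk σ)) = cosetLoop _ 1 σ :=
    FundamentalGroup.mapOfEq_apply (cosetProj (N.comap (i : S →* A))) rfl _
  rw [chi, MonoidHom.comp_apply, h]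
  exact cosetMapPi1_cosetLoop _ _ _ _ _ _ _ _ hθ

variable [IsTopologicalGroup A]

theorem connectingHom_cosetLoop (N : Subgroup A) [DiscreteTopology N] (a : N)
    (θ : Path (1 : A) a) : connectingHom N (cosetLoop N a θ) = a :=
  connectingHom_apply N a θ

/-- For a discrete subgroup, every class in `π₁(A / N)` comes from a path in `A`, namely from the
lift of a representing loop. -/
theorem exists_eq_cosetLoop (N : Subgroup A) [DiscreteTopology N] (y : CosetPi1 N) :
    ∃ θ : Path (1 : A) (connectingHom N y), y = cosetLoop N _ θ := by
  have cov := isCoveringMap_cosetProj N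
  obtain ⟨γ⟩ := y
  have h0 : γ 0 = (QuotientGroup.mk (1 : A) : A ⧸ N) := γ.source
  refine ⟨⟨cov.liftPath γ 1 h0, cov.liftPath_zero γ 1 h0, rfl⟩, ?_⟩
  refine congrArg Path.Homotopic.Quotient.mk (Path.ext (funext fun t => ?_))
  exact (congrFun (cov.liftPath_lifts γ 1 h0) t).symm

theorem cosetLoop_eq_iff (N : Subgroup A) [DiscreteTopology N] {a : N} {θ θ' : Path (1 : A) a} :
    cosetLoop N a θ = cosetLoop N a θ' ↔ θ.Homotopic θ' := by
  have cov := isCoveringMap_cosetProj N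
  have hcast {x y z w : A ⧸ N} (h : z = x) (h' : w = y) (γ γ' : Path x y) :
      Path.Homotopic.Quotient.mk (γ.cast h h') = Path.Homotopic.Quotient.mk (γ'.cast h h') ↔
        Path.Homotopic.Quotient.mk γ = Path.Homotopic.Quotient.mk γ' := by
    subst h h'; rfl
  refine (hcast _ _ _ _).trans ?_
  rw [← Path.Homotopic.Quotient.eq]
  exact (cov.injective_path_homotopic_map _ _).eq_iff
    (a := Path.Homotopic.Quotient.mk θ) (b := Path.Homotopic.Quotient.mk θ')

theorem cosetLoop_one_eq_one_iff (N : Subgroup A) [DiscreteTopology N]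
    {θ : Path (1 : A) (1 : N)} : cosetLoop N 1 θ = 1 ↔ θ.Homotopic (Path.refl 1) := by
  have h : cosetLoop N 1 (Path.refl (1 : A)) = 1 :=
    congrArg Path.Homotopic.Quotient.mk (Path.ext rfl)
  rw [← h]
  exact cosetLoop_eq_iff N

end CosetLoop

/-! ### The exact sequence -/

theorem theoremt
    {ES EG ET : Type*}
    [NormedAddCommGroup ES] [NormedSpace ℝ ES] [FiniteDimensional ℝ ES]
    [NormedAddCommGroup EG] [NormedSpace ℝ EG] [FiniteDimensional ℝ EG]
    [NormedAddCommGroup ET] [NormedSpace ℝ ET] [FiniteDimensional ℝ ET]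
    {S G T : Type*}
    [Group S] [TopologicalSpace S] [ChartedSpace ES S] [LieGroup 𝓘(ℝ, ES) ∞ S] [ConnectedSpace S]
    [Group G] [TopologicalSpace G] [ChartedSpace EG G] [LieGroup 𝓘(ℝ, EG) ∞ G] [ConnectedSpace G]
    [Group T] [TopologicalSpace T] [ChartedSpace ET T] [LieGroup 𝓘(ℝ, ET) ∞ T] [ConnectedSpace T]
    -- the next two follow from the `LieGroup` instances, but Mathlib does not infer them
    [IsTopologicalGroup G] [IsTopologicalGroup T]
    (i : S →ₜ* G) (τ : G →ₜ* T)
    (hi : ContMDiff 𝓘(ℝ, ES) 𝓘(ℝ, EG) ∞ i) (hτ : ContMDiff 𝓘(ℝ, EG) 𝓘(ℝ, ET) ∞ τ)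
    (hi_inj : Function.Injective i) (hexact : Function.MulExact i τ)
    (hτ_surj : Function.Surjective τ)
    (Γ : Subgroup G) [DiscreteTopology Γ] [DiscreteTopology (Γ.map (τ : G →* T))] :
    Function.MulExact (chi i Γ) (phi τ Γ) ∧ Function.Surjective (phi τ Γ) ∧
      (SimplyConnectedSpace S → Function.Bijective (phi τ Γ)) := by
  have : IsTopologicalGroup S := topologicalGroup_of_lieGroup 𝓘(ℝ, ES) ∞
  have : LocallyCompactSpace S := (LieGroup.locallyCompactSpace_and_t2Space (EG := ES) S).1
  obtain ⟨_, _⟩ := LieGroup.locallyCompactSpace_and_t2Space (EG := EG) G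
  obtain ⟨_, _⟩ := LieGroup.locallyCompactSpace_and_t2Space (EG := ET) T
  have := sigmaCompactSpace_of_connectedSpace S
  have := sigmaCompactSpace_of_connectedSpace G
  have : LocallyPathConnectedSpace S := ChartedSpace.locallyPathConnectedSpace ES S
  have : PathConnectedSpace S := pathConnectedSpace_iff_connectedSpace.2 inferInstance
  have hemb : Topology.IsEmbedding i := isEmbedding_of_mulExact i τ hi_inj hexact
  have hτi (s : S) : τ (i s) = 1 := (hexact (i s)).2 ⟨s, rfl⟩
  have hsec := exists_continuousOn_section_nhds_one τ hτ
    ((τ : G →* T).isOpenMap_of_sigmaCompact hτ_surj τ.continuous_toFun)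
  have hmem (g : G) (hg : g ∈ Γ) : τ g ∈ Γ.map (τ : G →* T) := Subgroup.mem_map_of_mem _ hg
  have hphi (y : CosetPi1 Γ) : phi τ Γ y = 1 ↔
      cosetMapPi1 τ Γ (Γ.map (τ : G →* T)) hmem y = 1 ∧ connectingHom Γ y = 1 := by
    rw [← Prod.mk_eq_one, ← Subtype.coe_inj]
    rfl
  have hexact' : Function.MulExact (chi i Γ) (phi τ Γ) := by
    intro y
    rw [hphi]
    constructor
    · rintro ⟨hy1, hy2⟩
      -- `y` is the class of the image of a loop `a` in `G`, and `τ ∘ a` is null-homotopic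
      obtain ⟨a, ha⟩ : ∃ a : Path (1 : G) (1 : Γ), y = cosetLoop Γ 1 a := by
        obtain ⟨θ, hθ⟩ := exists_eq_cosetLoop Γ y
        exact ⟨θ.cast rfl (by rw [hy2]), hθ.trans (cosetLoop_congr Γ fun t => rfl)⟩
      let p : Path (1 : T) (1 : Γ.map (τ : G →* T)) :=
        (a.map τ.continuous_toFun).cast (map_one τ).symm (map_one τ).symm
      rw [ha, cosetMapPi1_cosetLoop τ Γ _ hmem 1 a 1 p fun t => rfl,
        cosetLoop_one_eq_one_iff] at hy1
      obtain ⟨b, hb, hab⟩ := exists_homotopic_loop_in_ker τ hτ_surj hsec a p (fun t => rfl) hy1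
      choose σ hσ using fun t => (hexact (b t)).1 (hb t)
      have hσc : Continuous σ := by
        rw [hemb.continuous_iff]
        exact b.continuous.congr fun t => (hσ t).symm
      let s : Path (1 : S) 1 :=
        { toFun := σ
          continuous_toFun := hσc
          source' := hi_inj (by rw [hσ, b.source, map_one])
          target' := hi_inj (by rw [hσ, b.target, map_one]) }
      refine ⟨FundamentalGroup.fromPath (Path.Homotopic.Quotient.mk s), ?_⟩
      rw [chi_mk i Γ s b fun t => (hσ t).symm, ha, cosetLoop_eq_iff]
      exact hab.symm
    · rintro ⟨⟨s⟩, rfl⟩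
      let b : Path (1 : G) (1 : Γ) :=
        (s.map i.continuous_toFun).cast (map_one i).symm (map_one i).symm
      have h := chi_mk i Γ s b fun t => rfl
      change chi i Γ (Quot.mk _ s) = _ at h
      rw [h]
      refine ⟨?_, connectingHom_cosetLoop Γ 1 b⟩
      rw [cosetMapPi1_cosetLoop τ Γ _ hmem 1 b 1 (Path.refl 1) fun t => (hτi _).symm,
        cosetLoop_one_eq_one_iff]
  have hsurj : Function.Surjective (phi τ Γ) := by
    rintro ⟨⟨x, γ⟩, hx⟩
    have hxγ : (connectingHom (Γ.map (τ : G →* T)) x : T) = τ γ := congrArg Subtype.val hx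
    obtain ⟨α, hα⟩ := exists_eq_cosetLoop _ x
    obtain ⟨k, hk⟩ := exists_continuousMap_lift τ hτ_surj hsec (α : C(unitInterval, T))
    replace hk (t : unitInterval) : τ (k t) = α t := hk t
    -- the end point of the lift `t ↦ k t * (k 0)⁻¹` of `α` differs from `γ` by an element of `S`
    obtain ⟨s, hs⟩ := (hexact ((k 1 * (k 0)⁻¹)⁻¹ * γ)).1 (by simp [hk, hxγ])
    obtain ⟨ς⟩ := PathConnectedSpace.joined (1 : S) s
    let θ : Path (1 : G) γ :=
      { toFun := fun t => k t * (k 0)⁻¹ * i (ς t)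
        continuous_toFun :=
          (k.continuous.mul continuous_const).mul (i.continuous_toFun.comp ς.continuous)
        source' := by simp
        target' := by rw [ς.target, hs, mul_inv_cancel_left] }
    refine ⟨cosetLoop Γ γ θ, Subtype.ext (Prod.ext ?_ (connectingHom_cosetLoop Γ γ θ))⟩
    refine Eq.trans ?_ hα.symm
    refine cosetMapPi1_cosetLoop τ Γ _ hmem γ θ _ α fun t => ?_
    change α t = τ (k t * (k 0)⁻¹ * i (ς t))
    simp [hk, hτi]
  refine ⟨hexact', hsurj, fun _ => ⟨?_, hsurj⟩⟩
  rw [injective_iff_map_eq_one]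
  intro y hy
  obtain ⟨x, rfl⟩ := (hexact' y).1 hy
  have hx : x = 1 := Subsingleton.elim (α := Path.Homotopic.Quotient (1 : S) 1) x _
  rw [hx, map_one]
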